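/- Let $S=\bigoplus_{d\ge 0}S_d$ be a Noetherian Cohen--Macaulay domain that is a nonnegatively graded algebra over a field $k$ (so $k\to S_0$), and let $I$ be a nonzero proper homogeneous ideal of $S$ of height $c$. Assume that $I$ is unmixed (every $p\in\operatorname{Ass}_S(S/I)$ has height $c$) and generically a complete intersection (for every $p\in\operatorname{Ass}_S(S/I)$ the ideal $I_p$ is generated by an $S_p$-regular sequence). For $m\ge 1$ let $$I^{(m)}=\bigcap_{p\in\operatorname{Ass}_S(S/I)} \left(I^mS_p\cap S\right)$$ be the $m$-th symbolic power of $I$. Let $\mathbf F_c(I)$ be the $c$-th Fitting ideal of the $S$-module $I$, that is, the ideal generated by the $(n-c)$-minors of the matrix of any finite free presentation $S^q\to S^n\to I\to 0$ (and $\mathbf F_c(I)=S$ if $c\ge n$). For a nonzero homogeneous ideal $J$ let $\alpha(J)$ be the least degree of a nonzero homogeneous element of $J$. Let $m\ge 1$. For every integer $t_0\ge 0$ such that $I^{(m)}=I^m:\mathbf F_c(I)^{t_0}$ one has $$\alpha(I^{(m)})\ \ge\ m\,\alpha(I)-t_0\,\alpha(\mathbf F_c(I)).$$ In particular, without any assumption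 on $t_0$, one always has $$\alpha(I^{(m)})\ \ge\ m\bigl(\alpha(I)-\alpha(\mathbf F_c(I))\bigr)+\alpha(\mathbf F_c(I)).$$ -/

import Mathlib

/-- A local ring `R` is Cohen-Macaulay if there is an `R`-regular sequence whose length is the Krull
dimension of `R`. (`IsRegular` includes `(rs) ≠ R`, so the members of `rs` are nonunits.) -/
def IsCohenMacaulayLocal (R : Type*) [CommRing R] [IsLocalRing R] : Prop :=
  ∃ rs : List R, RingTheory.Sequence.IsRegular R rs ∧
    ((rs.length : ℕ) : WithBot ℕ∞) = ringKrullDim R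

/-- A (Noetherian) ring is Cohen-Macaulay if all its localizations at primes are. -/
def IsCohenMacaulayRing (S : Type*) [CommRing S] : Prop :=
  ∀ (p : Ideal S) [p.IsPrime], IsCohenMacaulayLocal (Localization.AtPrime p)

/-- `I` is unmixed of height `c`: every associated prime of `S ⧸ I` has height `c`. -/
def IsUnmixedOfHeight {S : Type*} [CommRing S] (I : Ideal S) (c : ℕ) : Prop :=
  ∀ p ∈ associatedPrimes S (S ⧸ I), p.height = c

/-- `I` is generically a complete intersection: for every associated prime `p` of `S ⧸ I`, the ideal
`I_p` is generated by an `S_p`-regular sequence. -/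
def IsGenericallyCompleteIntersection {S : Type*} [CommRing S] (I : Ideal S) : Prop :=
  ∀ (p : Ideal S) [p.IsPrime], p ∈ associatedPrimes S (S ⧸ I) →
    ∃ rs : List (Localization.AtPrime p),
      RingTheory.Sequence.IsRegular (Localization.AtPrime p) rs ∧
        Ideal.ofList rs = I.map (algebraMap S (Localization.AtPrime p))

/-- The `m`-th symbolic power `I^(m)`, the intersection of the contractions `I^m S_p ∩ S` over the
associated primes `p` of `S ⧸ I`. -/
def symbolicPower {S : Type*} [CommRing S] (I : Ideal S) (m : ℕ) : Ideal S :=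
  ⨅ (p : PrimeSpectrum S) (_ : p.asIdeal ∈ associatedPrimes S (S ⧸ I)),
    ((I ^ m).map (algebraMap S (Localization.AtPrime p.asIdeal))).comap
      (algebraMap S (Localization.AtPrime p.asIdeal))

/-- `I_r(φ)`: the ideal generated by the `r`-minors of the matrix `φ`. (A choice of rows or columns
with a repetition contributes a zero determinant; `I_0(φ)` is the unit ideal.) -/
def minorsIdeal {S : Type*} [CommRing S] {n q : ℕ} (φ : Matrix (Fin n) (Fin q) S) (r : ℕ) :
    Ideal S :=
  Ideal.span {d | ∃ (a : Fin r → Fin n) (b : Fin r → Fin q), d = (φ.submatrix a b).det}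

/-- `φ` is a presentation matrix of `M`: there is an exact sequence `S^q → S^n → M → 0` whose first
map is `φ`. -/
def IsPresentationMatrix {S : Type*} [CommRing S] (M : Type*) [AddCommGroup M] [Module S M]
    {n q : ℕ} (φ : Matrix (Fin n) (Fin q) S) : Prop :=
  ∃ π : (Fin n → S) →ₗ[S] M, Function.Surjective π ∧
    LinearMap.ker π = LinearMap.range φ.mulVecLin

/-- The `j`-th Fitting ideal `F_j(M) = I_{n-j}(φ)` of a finitely presented module `M`, where `φ` is
any presentation matrix of `M`, with `n` rows, and `F_j(M) = S` if `j ≥ n` (here the truncated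
difference `n - j` is `0`). As `I_{n-j}(φ)` does not depend on `φ`, the supremum over all finite
presentations is the common value. -/
def fittingIdeal (S : Type*) [CommRing S] (M : Type*) [AddCommGroup M] [Module S M] (j : ℕ) :
    Ideal S :=
  ⨆ (n : ℕ) (q : ℕ) (φ : Matrix (Fin n) (Fin q) S) (_ : IsPresentationMatrix M φ),
    minorsIdeal φ (n - j)

/-- The initial degree `α(J)` of a nonzero homogeneous ideal `J` of a graded ring: the least degree
of a nonzero homogeneous element of `J`. -/
noncomputable def initialDegree {k S : Type*} [CommSemiring k] [CommRing S] [Algebra k S]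
    (𝒜 : ℕ → Submodule k S) (J : Ideal S) : ℕ :=
  sInf {d : ℕ | ∃ f ∈ J, f ∈ 𝒜 d ∧ f ≠ 0}

/-! Both bounds compare degrees in a domain: if `g ^ t * f ∈ I ^ m`, where the lowest term of `g`
has degree at most `e` and `f ≠ 0` is homogeneous of degree `d`, then `m α(I) ≤ t e + d`. The first
bound takes least-degree elements `f` of `I^(m)` and `g` of the Fitting ideal.

For the second, with `m = t + 1`, it suffices to find one `g` of order at most `α(F_c(I))` such that
`g ^ t` multiplies `I^(m)` into `I ^ m`. Let `g` be an `(n - c)`-minor of relations among `n`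
generators of `I`. By Cramer's rule `g I` lies in the ideal `J` of the remaining generators, at most
`c` in number (`IsRelationMinor.mul_mem`). If these form a regular sequence, the associated primes
of `J` have height at most `c` (`Ideal.height_le_of_mem_associatedPrimes`), nonzerodivisors on `S ⧸
I` stay so on `J ^ i ⧸ J ^ i * I` (`Ideal.mem_pow_mul_of_isRegularMod`), and `g` works
(`pow_mul_mem_of_mem_symbolicPower`).

Regularity is arranged by prime avoidance, adding to a generator multiples `u * f i` with `u ∈ I`
(`IsRelationMinor.exists_isRegularSeqMod`). Each such change alters `g` by `u` times another minor.
If `α(I) > 0` and `g` has least order among all minors, the correction has strictly larger order, so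
the order of `g` survives. -/

namespace Ideal

/-! ### Regular sequences modulo an ideal, and powers of the ideals they generate -/

section RegularMod

variable {R : Type*} [CommRing R]

/-- Multiplication by `x` is injective on `R ⧸ J`. -/
def IsRegularMod (J : Ideal R) (x : R) : Prop := ∀ a, x * a ∈ J → a ∈ J

/-- `xs` is a weakly regular sequence on `R ⧸ J`. -/
def IsRegularSeqMod : Ideal R → List R → Prop
  | _, [] => True
  | J, x :: xs => J.IsRegularMod x ∧ IsRegularSeqMod (J ⊔ span {x}) xs

/-- Some nonzero element of `R ⧸ J` is annihilated by `p`. -/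
def HasSocle (p J : Ideal R) : Prop := ∃ s, s ∉ J ∧ ∀ a ∈ p, a * s ∈ J

theorem isRegularSeqMod_append {J : Ideal R} {xs ys : List R} :
    J.IsRegularSeqMod (xs ++ ys) ↔
      J.IsRegularSeqMod xs ∧ (J ⊔ ofList xs).IsRegularSeqMod ys := by
  induction xs generalizing J with
  | nil => simp [IsRegularSeqMod]
  | cons x xs ih =>
    simp only [List.cons_append, IsRegularSeqMod, ih, ofList_cons, sup_assoc, and_assoc]

theorem isRegularSeqMod_concat {J : Ideal R} {xs : List R} {x : R} :
    J.IsRegularSeqMod (xs ++ [x]) ↔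
      J.IsRegularSeqMod xs ∧ (J ⊔ ofList xs).IsRegularMod x := by
  simp [isRegularSeqMod_append, IsRegularSeqMod]

theorem mem_sup_span_singleton {J : Ideal R} {x a : R} :
    a ∈ J ⊔ span {x} ↔ ∃ j ∈ J, ∃ b, a = j + x * b := by
  simp only [Submodule.mem_sup, mem_span_singleton', exists_exists_eq_and]
  constructor
  · rintro ⟨j, hj, b, rfl⟩
    exact ⟨j, hj, b, by ring⟩
  · rintro ⟨j, hj, b, rfl⟩
    exact ⟨j, hj, b, by ring⟩

/-- The half of permutability of regular sequences that needs no local hypothesis. -/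
theorem IsRegularMod.swap {J : Ideal R} {x z : R} (hx : J.IsRegularMod x)
    (hz : (J ⊔ span {x}).IsRegularMod z) : (J ⊔ span {z}).IsRegularMod x := by
  intro a ha
  obtain ⟨j, hj, b, hb⟩ := mem_sup_span_singleton.1 ha
  have h1 : b ∈ J ⊔ span {x} := hz b <| mem_sup_span_singleton.2
    ⟨-j, J.neg_mem hj, a, by linear_combination -hb⟩
  obtain ⟨j', hj', b', rfl⟩ := mem_sup_span_singleton.1 h1
  have h2 : a - z * b' ∈ J := hx _ <| by
    have : x * (a - z * b') = j + z * j' := by linear_combination hb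
    rw [this]
    exact J.add_mem hj (J.mul_mem_left _ hj')
  exact mem_sup_span_singleton.2 ⟨_, h2, b', by ring⟩

theorem IsRegularSeqMod.sup_span_singleton {J : Ideal R} {xs : List R} {z : R}
    (h : J.IsRegularSeqMod xs) (hz : ∀ l, l <+: xs → (J ⊔ ofList l).IsRegularMod z) :
    (J ⊔ span {z}).IsRegularSeqMod xs := by
  induction xs generalizing J with
  | nil => trivial
  | cons x xs ih =>
    refine ⟨h.1.swap ?_, ?_⟩
    · simpa using hz [x] (by simp)
    · rw [sup_right_comm]
      refine ih h.2 fun l hl => ?_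
      simpa [sup_assoc] using hz (x :: l) (by simpa using hl)

theorem IsRegularSeqMod.exists_isRegularMod_of_prefix {J : Ideal R} {xs l : List R} {x : R}
    (h : J.IsRegularSeqMod (xs ++ [x])) (hl : l <+: xs) :
    ∃ y ∈ xs ++ [x], (J ⊔ ofList l).IsRegularMod y := by
  obtain ⟨t, rfl⟩ := hl
  rw [List.append_assoc, isRegularSeqMod_append] at h
  cases t with
  | nil => exact ⟨x, by simp, h.2.1⟩
  | cons y t => exact ⟨y, by simp, h.2.1⟩

/-- An elementwise form of `Hom(R/p, R/(J, x)) ≅ Ext¹(R/p, R/J) ≅ Hom(R/p, R/(J, z))`: writing `z *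
s = j + x * t` sends the socle element `s` to `t`. -/
theorem HasSocle.exchange {p J : Ideal R} {x z : R} (hzp : z ∈ p)
    (hx : J.IsRegularMod x) (hz : J.IsRegularMod z) (h : HasSocle p (J ⊔ span {x})) :
    HasSocle p (J ⊔ span {z}) := by
  obtain ⟨s, hs, hps⟩ := h
  obtain ⟨j, hj, t, ht⟩ := mem_sup_span_singleton.1 (hps z hzp)
  refine ⟨t, fun hmem => hs ?_, fun a ha => ?_⟩
  · obtain ⟨j', hj', t', rfl⟩ := mem_sup_span_singleton.1 hmem
    have : s - x * t' ∈ J := hz _ <| by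
      have : z * (s - x * t') = j + x * j' := by linear_combination ht
      rw [this]
      exact J.add_mem hj (J.mul_mem_left _ hj')
    exact mem_sup_span_singleton.2 ⟨_, this, t', by ring⟩
  · obtain ⟨j', hj', b, hb⟩ := mem_sup_span_singleton.1 (hps a ha)
    have : a * t - z * b ∈ J := hx _ <| by
      have : x * (a * t - z * b) = z * j' - a * j := by linear_combination (-a) * ht + z * hb
      rw [this]
      exact J.sub_mem (J.mul_mem_left _ hj') (J.mul_mem_left _ hj)
    exact mem_sup_span_singleton.2 ⟨_, this, b, by ring⟩

theorem HasSocle.not_isRegularMod {p J : Ideal R} {x : R} (h : HasSocle p J) (hx : x ∈ p) :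
    ¬ J.IsRegularMod x := fun hreg => by
  obtain ⟨s, hs, hps⟩ := h
  exact hs (hreg s (hps x hx))

theorem hasSocle_of_mem_associatedPrimes [IsNoetherianRing R] {p J : Ideal R}
    (hp : p ∈ associatedPrimes R (R ⧸ J)) : ∃ s, s ∉ J ∧ ∀ a, a ∈ p ↔ a * s ∈ J := by
  obtain ⟨hprime, x, hx⟩ := isAssociatedPrime_iff.1 (AssociatedPrimes.mem_iff.1 hp)
  obtain ⟨s, rfl⟩ := Quotient.mk_surjective x
  have key : ∀ a, a ∈ p ↔ a * s ∈ J := fun a => by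
    rw [hx, Submodule.mem_colon_singleton, Submodule.mem_bot, ← Quotient.eq_zero_iff_mem, map_mul]
    rfl
  refine ⟨s, fun hs => hprime.ne_top ((eq_top_iff_one _).2 ((key 1).2 (by simpa using hs))), key⟩

theorem le_of_mem_associatedPrimes [IsNoetherianRing R] {p J : Ideal R}
    (hp : p ∈ associatedPrimes R (R ⧸ J)) : J ≤ p := fun a ha => by
  obtain ⟨s, -, h⟩ := hasSocle_of_mem_associatedPrimes hp
  exact (h a).2 (J.mul_mem_right _ ha)

theorem isRegularMod_iff_forall_notMem [IsNoetherianRing R] {J : Ideal R} {x : R} :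
    J.IsRegularMod x ↔ ∀ p ∈ associatedPrimes R (R ⧸ J), x ∉ p := by
  have h := Set.ext_iff.1 (biUnion_associatedPrimes_eq_zero_divisors R (R ⧸ J)) x
  rw [← not_iff_not]
  simp only [Set.mem_iUnion, SetLike.mem_coe, exists_prop, Set.mem_ofPred_eq] at h
  push Not
  rw [h]
  simp only [IsRegularMod]
  push Not
  constructor
  · rintro ⟨a, ha, ha'⟩
    exact ⟨Quotient.mk J a, by rwa [Ne, Quotient.eq_zero_iff_mem],
      by rw [← Quotient.eq_zero_iff_mem, map_mul] at ha; exact ha⟩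
  · rintro ⟨y, hy, hxy⟩
    obtain ⟨a, rfl⟩ := Quotient.mk_surjective y
    exact ⟨a, by rw [← Quotient.eq_zero_iff_mem, map_mul]; exact hxy,
      by rwa [Ne, Quotient.eq_zero_iff_mem] at hy⟩

theorem finite_associatedPrimes_quotient [IsNoetherianRing R] (J : Ideal R) :
    (associatedPrimes R (R ⧸ J)).Finite := associatedPrimes.finite R (R ⧸ J)

/-- An ideal contained in no associated prime of any `R ⧸ J`, `J ∈ Js`, contains an element regular
on all of them. -/
theorem exists_isRegularMod_forall [IsNoetherianRing R] (K : Ideal R) {Js : Set (Ideal R)}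
    (hfin : Js.Finite) (h : ∀ J ∈ Js, ∀ p ∈ associatedPrimes R (R ⧸ J), ¬ K ≤ p) :
    ∃ z ∈ K, ∀ J ∈ Js, J.IsRegularMod z := by
  have hs : (⋃ J ∈ Js, associatedPrimes R (R ⧸ J)).Finite :=
    hfin.biUnion fun J _ => finite_associatedPrimes_quotient J
  have := (subset_union_prime_finite hs (f := id) (I := K) ⊥ ⊥ (fun p hp _ _ => by
    simp only [Set.mem_iUnion] at hp
    obtain ⟨J, -, hp⟩ := hp
    exact IsAssociatedPrime.isPrime hp)).not.2 (by
      rintro ⟨p, hp, hle⟩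
      simp only [Set.mem_iUnion] at hp
      obtain ⟨J, hJ, hp⟩ := hp
      exact h J hJ p hp hle)
  obtain ⟨z, hz, hz'⟩ := Set.not_subset.1 this
  refine ⟨z, hz, fun J hJ => isRegularMod_iff_forall_notMem.2 fun p hp hzp => hz' ?_⟩
  exact Set.mem_biUnion (Set.mem_biUnion hJ hp) hzp

/-- Two weakly regular sequences of the same length in `p` have quotients with the same
"depth zero" behaviour at `p`. -/
theorem HasSocle.of_isRegularSeqMod [IsNoetherianRing R] {p : Ideal R} (r : ℕ) :
    ∀ {J : Ideal R} {xs ys : List R}, xs.length = r → ys.length = r →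
      (∀ x ∈ xs, x ∈ p) → (∀ y ∈ ys, y ∈ p) → J.IsRegularSeqMod xs → J.IsRegularSeqMod ys →
      HasSocle p (J ⊔ ofList xs) → HasSocle p (J ⊔ ofList ys) := by
  induction r with
  | zero =>
    intro J xs ys hxl hyl _ _ _ _ h
    rw [List.length_eq_zero_iff] at hxl hyl
    rwa [hyl, ← hxl]
  | succ r ih =>
    intro J xs ys hxl hyl hxp hyp hx hy h
    obtain ⟨xs, x, rfl⟩ := (List.eq_nil_or_concat' xs).resolve_left (by rintro rfl; simp at hxl)
    obtain ⟨ys, y, rfl⟩ := (List.eq_nil_or_concat' ys).resolve_left (by rintro rfl; simp at hyl)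
    -- One `z ∈ p` regular modulo every prefix of both shortened sequences can replace `x`, move to
    -- the front for the induction over `J ⊔ span {z}`, and finally be exchanged for `y`.
    let Js : Set (Ideal R) := {K | ∃ l ∈ xs.inits ++ ys.inits, K = J ⊔ ofList l}
    have hfin : Js.Finite := by
      refine ((List.finite_toSet (xs.inits ++ ys.inits)).image fun l => J ⊔ ofList l).subset ?_
      rintro _ ⟨l, hl, rfl⟩
      exact ⟨l, hl, rfl⟩
    obtain ⟨z, hzp, hz⟩ := exists_isRegularMod_forall p hfin (by
      rintro _ ⟨l, hl, rfl⟩ q hq hpq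
      simp only [List.mem_append, List.mem_inits] at hl
      have : ∃ w ∈ p, (J ⊔ ofList l).IsRegularMod w := by
        rcases hl with hl | hl
        · obtain ⟨w, hw, hw'⟩ := hx.exists_isRegularMod_of_prefix hl
          exact ⟨w, hxp w hw, hw'⟩
        · obtain ⟨w, hw, hw'⟩ := hy.exists_isRegularMod_of_prefix hl
          exact ⟨w, hyp w hw, hw'⟩
      obtain ⟨w, hwp, hw⟩ := this
      exact isRegularMod_iff_forall_notMem.1 hw q hq (hpq hwp))
    have hzx : ∀ l, l <+: xs → (J ⊔ ofList l).IsRegularMod z := fun l hl =>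
      hz _ ⟨l, by simp [hl], rfl⟩
    have hzy : ∀ l, l <+: ys → (J ⊔ ofList l).IsRegularMod z := fun l hl =>
      hz _ ⟨l, by simp [hl], rfl⟩
    rw [isRegularSeqMod_concat] at hx hy
    rw [ofList_append, ofList_singleton, ← sup_assoc] at h ⊢
    have h1 := h.exchange hzp hx.2 (hzx xs List.prefix_rfl)
    rw [sup_right_comm] at h1
    have h2 := ih (by simpa using hxl) (by simpa using hyl)
      (fun w hw => hxp w (by simp [hw])) (fun w hw => hyp w (by simp [hw]))
      (hx.1.sup_span_singleton hzx) (hy.1.sup_span_singleton hzy) h1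
    rw [sup_right_comm] at h2
    exact h2.exchange (hyp y (by simp)) (hzy ys List.prefix_rfl) hy.2

/-- If `p` contains a weakly regular sequence of length `d` and annihilates a nonzero element
modulo the weakly regular sequence `xs`, then `d ≤ xs.length`. -/
theorem HasSocle.length_le [IsNoetherianRing R] {p : Ideal R} {xs ys : List R}
    (hxp : ∀ x ∈ xs, x ∈ p) (hyp : ∀ y ∈ ys, y ∈ p)
    (hx : (⊥ : Ideal R).IsRegularSeqMod xs) (hy : (⊥ : Ideal R).IsRegularSeqMod ys)
    (h : HasSocle p (ofList xs)) : ys.length ≤ xs.length := by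
  by_contra! hlt
  have hsplit : ys = ys.take xs.length ++ ys.drop xs.length := (List.take_append_drop _ _).symm
  have hy' := hy
  rw [hsplit, isRegularSeqMod_append] at hy'
  have hs := HasSocle.of_isRegularSeqMod (p := p) xs.length rfl
    (ys := ys.take xs.length) (by simp [hlt.le]) hxp
    (fun y hm => hyp y (List.mem_of_mem_take hm)) hx hy'.1 (by simpa using h)
  cases hd : ys.drop xs.length with
  | nil => rw [List.drop_eq_nil_iff] at hd; omega
  | cons y t =>
    rw [hd] at hy'
    refine hs.not_isRegularMod (hyp y ?_) hy'.2.1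
    exact List.mem_of_mem_drop (i := xs.length) (by simp [hd])

/-- Let `xs` be a weakly regular sequence generating `J ≤ I`. A nonzerodivisor `s` on `R ⧸ I` is
a nonzerodivisor on `J ^ t ⧸ J ^ t * I`. -/
theorem mem_pow_mul_of_isRegularMod {xs : List R} (hxs : (⊥ : Ideal R).IsRegularSeqMod xs)
    (t : ℕ) {I : Ideal R} (hI : ofList xs ≤ I) {s : R} (hs : I.IsRegularMod s) {w : R}
    (hw : w ∈ ofList xs ^ t) (hsw : s * w ∈ ofList xs ^ t * I) : w ∈ ofList xs ^ t * I := by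
  induction xs using List.reverseRecOn generalizing t I s w with
  | nil =>
    cases t with
    | zero => simpa using hs w (by simpa using hsw)
    | succ t => simp_all
  | append_singleton xs x ih =>
    rw [isRegularSeqMod_concat, bot_sup_eq] at hxs
    have hJ : ofList (xs ++ [x]) = ofList xs ⊔ span {x} := by simp
    rw [hJ] at hI hw hsw ⊢
    set J' := ofList xs with hJ'
    -- The outer induction hypothesis with `I = J'` and `s = x` lifts regularity of `x` from `J'` to
    -- its powers.
    have hregpow : ∀ t, (J' ^ t).IsRegularMod x := by
      intro t
      induction t with
      | zero => intro a _; simp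
      | succ t iht =>
        intro a ha
        have h1 := iht a (pow_le_pow_right (Nat.le_succ t) ha)
        rw [pow_succ] at ha ⊢
        exact ih hxs.1 t le_rfl hxs.2 h1 ha
    induction t generalizing w with
    | zero => simpa using hs w (by simpa using hsw)
    | succ t iht =>
      have hpow : (J' ⊔ span {x}) ^ (t + 1) = J' ^ (t + 1) ⊔ span {x} * (J' ⊔ span {x}) ^ t := by
        apply le_antisymm
        · clear * -
          induction t with
          | zero => simp
          | succ t ih =>
            rw [pow_succ', sup_mul]
            refine sup_le ((mul_mono_right ih).trans ?_) le_sup_right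
            rw [mul_sup]
            refine sup_le (le_sup_of_le_left (by rw [pow_succ' J' (t + 1)])) (le_sup_of_le_right ?_)
            rw [mul_left_comm]
            refine mul_mono_right ?_
            rw [pow_succ']
            exact mul_mono_left le_sup_left
        · refine sup_le (pow_right_mono le_sup_left _) ?_
          rw [pow_succ']
          exact mul_mono_left le_sup_right
      have hmem : ∀ {K L : Ideal R} {v : R}, v ∈ K ⊔ span {x} * L →
          ∃ a ∈ K, ∃ b ∈ L, v = a + x * b := by
        intro K L v hv
        obtain ⟨a, ha, c, hc, rfl⟩ := Submodule.mem_sup.1 hv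
        obtain ⟨b, hb, rfl⟩ := mem_span_singleton_mul.1 hc
        exact ⟨a, ha, b, hb, rfl⟩
      have hle : J' ^ (t + 1) ≤ (J' ⊔ span {x}) ^ t * I := by
        rw [pow_succ]
        exact mul_mono (pow_right_mono le_sup_left _) (le_sup_left.trans hI)
      rw [hpow] at hw hsw ⊢
      rw [sup_mul, mul_assoc] at hsw ⊢
      obtain ⟨a, ha, b, hb, rfl⟩ := hmem hw
      obtain ⟨a₁, ha₁, b₁, hb₁, heq⟩ := hmem hsw
      -- Cancelling `x` separates the two parts of `w = a + x * b`: the inner induction then handles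
      -- `b`, the outer one `a`.
      have hh : s * b - b₁ ∈ J' ^ (t + 1) := hregpow _ _ <| by
        have : x * (s * b - b₁) = a₁ - s * a := by linear_combination heq
        rw [this]
        have ha₁' : a₁ ∈ J' ^ (t + 1) := Ideal.mul_le_left ha₁
        exact Ideal.sub_mem _ ha₁' (Ideal.mul_mem_left _ s ha)
      have hb' : b ∈ (J' ⊔ span {x}) ^ t * I := iht hb <| by
        have := add_mem (hle hh) hb₁
        simpa using this
      have ha' : a ∈ J' ^ (t + 1) * I := ih hxs.1 (t + 1) (le_sup_left.trans hI) hs ha <| by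
        have : s * a = a₁ - (s * b - b₁) * x := by linear_combination heq
        rw [this]
        have hx : x ∈ I := hI (Ideal.mem_sup_right (mem_span_singleton_self x))
        exact Ideal.sub_mem _ ha₁ (Ideal.mul_mem_mul hh hx)
      exact Submodule.add_mem_sup ha' (mul_mem_mul (mem_span_singleton_self x) hb')

end RegularMod

/-! ### Heights of associated primes in Cohen–Macaulay rings -/

section CohenMacaulay

open RingTheory.Sequence

theorem isRegularSeqMod_iff_isWeaklyRegular {R : Type*} [CommRing R] {rs : List R} :
    (⊥ : Ideal R).IsRegularSeqMod rs ↔ IsWeaklyRegular R rs := by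
  have key : ∀ (J : Ideal R) (x : R), J.IsRegularMod x ↔
      IsSMulRegular (R ⧸ (J • ⊤ : Submodule R R)) x := by
    intro J x
    have hJ : (J • ⊤ : Submodule R R) = J := by simp
    rw [hJ, isSMulRegular_iff_right_eq_zero_of_smul]
    constructor
    · intro h y hy
      obtain ⟨a, rfl⟩ := Quotient.mk_surjective y
      rw [Quotient.eq_zero_iff_mem]
      refine h a ?_
      rw [← Quotient.eq_zero_iff_mem, map_mul]
      exact hy
    · intro h a ha
      rw [← Quotient.eq_zero_iff_mem] at ha ⊢
      exact h _ (by rw [map_mul] at ha; exact ha)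
  induction rs using List.reverseRecOn with
  | nil => simp [IsRegularSeqMod]
  | append_singleton xs x ih =>
    rw [isRegularSeqMod_concat, isWeaklyRegular_append_iff, isWeaklyRegular_singleton_iff,
      bot_sup_eq, key]
    exact and_congr_left fun _ => ih

/-- In a Cohen-Macaulay ring, the associated primes of an ideal generated by a weakly regular
sequence have height at most the length of the sequence. -/
theorem height_le_of_mem_associatedPrimes {S : Type*} [CommRing S] [IsNoetherianRing S]
    (hCM : IsCohenMacaulayRing S) {xs : List S} (hxs : (⊥ : Ideal S).IsRegularSeqMod xs)
    {p : Ideal S} (hp : p ∈ associatedPrimes S (S ⧸ ofList xs)) : p.height ≤ xs.length := by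
  have hprime : p.IsPrime := IsAssociatedPrime.isPrime hp
  obtain ⟨rs, hrs, hlen⟩ := hCM p
  rw [IsLocalization.AtPrime.ringKrullDim_eq_height p (Localization.AtPrime p)] at hlen
  have hlen' : p.height = rs.length := by exact_mod_cast hlen.symm
  rw [hlen', Nat.cast_le]
  let A := Localization.AtPrime p
  have hxA : IsWeaklyRegular A (xs.map (algebraMap S A)) :=
    (isRegularSeqMod_iff_isWeaklyRegular.1 hxs).of_flat
  have hle : ofList xs ≤ p := le_of_mem_associatedPrimes hp
  obtain ⟨s, hs, hps⟩ := hasSocle_of_mem_associatedPrimes hp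
  have hmap : ofList (xs.map (algebraMap S A)) = (ofList xs).map (algebraMap S A) := by simp
  -- The socle element survives localization at `p`, so `A` modulo `xs` has depth zero; comparison
  -- with a regular sequence of length `p.height` bounds the height.
  have hsoc : HasSocle (IsLocalRing.maximalIdeal A) (ofList (xs.map (algebraMap S A))) := by
    rw [hmap]
    refine ⟨algebraMap S A s, fun hmem => ?_, fun a ha => ?_⟩
    · obtain ⟨t, ht, h⟩ := (IsLocalization.algebraMap_mem_map_algebraMap_iff p.primeCompl A _ _).1
        hmem
      exact ht ((hps t).2 h)
    · rw [← Localization.AtPrime.map_eq_maximalIdeal] at ha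
      have : (p.map (algebraMap S A)) * span {algebraMap S A s} ≤ (ofList xs).map (algebraMap S A) := by
        rw [← Set.image_singleton, ← map_span, ← Ideal.map_mul]
        refine map_mono ?_
        rw [mul_le]
        intro b hb c hc
        obtain ⟨d, rfl⟩ := mem_span_singleton'.1 hc
        rw [mul_left_comm]
        exact mul_mem_left _ _ ((hps b).1 hb)
      exact this (mul_mem_mul ha (mem_span_singleton_self _))
  have := hsoc.length_le (ys := rs) ?_ ?_ (isRegularSeqMod_iff_isWeaklyRegular.2 hxA)
    (isRegularSeqMod_iff_isWeaklyRegular.2 hrs.toIsWeaklyRegular)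
  · simpa using this
  · intro x hx
    obtain ⟨y, hy, rfl⟩ := List.mem_map.1 hx
    rw [← Localization.AtPrime.map_eq_maximalIdeal]
    exact mem_map_of_mem _ (hle (subset_span hy))
  · intro y hy
    refine IsLocalRing.le_maximalIdeal (J := ofList rs) (fun h => hrs.top_ne_smul ?_)
      (subset_span hy)
    rw [h]; simp

end CohenMacaulay

end Ideal

/-! ### The order filtration of a graded ring -/

section OrderGE

variable {k S : Type*} [Field k] [CommRing S] [Algebra k S] (𝒜 : ℕ → Submodule k S)

/-- The ideal generated by the homogeneous elements of degree at least `e`. -/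
def orderGE (e : ℕ) : Ideal S := Ideal.span {x | ∃ i, e ≤ i ∧ x ∈ 𝒜 i}

theorem orderGE_antitone : Antitone (orderGE 𝒜) := fun _ _ h =>
  Ideal.span_mono fun _ ⟨i, hi, hx⟩ => ⟨i, h.trans hi, hx⟩

variable {𝒜} in
theorem mem_orderGE_of_mem {e i : ℕ} (h : e ≤ i) {x : S} (hx : x ∈ 𝒜 i) : x ∈ orderGE 𝒜 e :=
  Ideal.subset_span ⟨i, h, hx⟩

variable {𝒜} in
theorem exists_mem_initialDegree {J : Ideal S} (h : ∃ d, ∃ f ∈ J, f ∈ 𝒜 d ∧ f ≠ 0) :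
    ∃ f ∈ J, f ∈ 𝒜 (initialDegree 𝒜 J) ∧ f ≠ 0 :=
  Nat.sInf_mem (s := {d : ℕ | ∃ f ∈ J, f ∈ 𝒜 d ∧ f ≠ 0}) h

variable [GradedAlgebra 𝒜]

theorem orderGE_zero : orderGE 𝒜 0 = ⊤ :=
  (Ideal.eq_top_iff_one _).2 (mem_orderGE_of_mem le_rfl (SetLike.one_mem_graded 𝒜))

theorem mem_orderGE_iff {e : ℕ} {x : S} :
    x ∈ orderGE 𝒜 e ↔ ∀ i < e, (DirectSum.decompose 𝒜 x i : S) = 0 := by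
  classical
  constructor
  · intro hx
    -- The arbitrary factor `b` makes the claim stable under scalar multiplication in the span
    -- induction.
    suffices h : ∀ b : S, ∀ i < e, (DirectSum.decompose 𝒜 (b * x) i : S) = 0 by
      simpa using h 1
    induction hx using Submodule.span_induction with
    | mem x hx =>
      obtain ⟨j, hj, hx⟩ := hx
      intro b i hi
      exact DirectSum.coe_decompose_mul_of_right_mem_of_not_le 𝒜 hx (by omega)
    | zero => simp
    | add x y _ _ hx hy =>
      intro b i hi
      rw [mul_add, DirectSum.decompose_add, DirectSum.add_apply, Submodule.coe_add, hx b i hi,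
        hy b i hi, add_zero]
    | smul a x _ hx =>
      intro b i hi
      rw [smul_eq_mul, ← mul_assoc]
      exact hx _ i hi
  · intro h
    rw [← DirectSum.sum_support_decompose 𝒜 x]
    refine sum_mem fun i hi => ?_
    refine mem_orderGE_of_mem (i := i) ?_ (SetLike.coe_mem _)
    by_contra! hlt
    have := h i hlt
    rw [ZeroMemClass.coe_eq_zero] at this
    simp [this] at hi

theorem mul_mem_orderGE {i j : ℕ} {x y : S} (hx : x ∈ orderGE 𝒜 i) (hy : y ∈ orderGE 𝒜 j) :
    x * y ∈ orderGE 𝒜 (i + j) := by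
  have h : orderGE 𝒜 i * orderGE 𝒜 j ≤ orderGE 𝒜 (i + j) := by
    rw [orderGE, orderGE, Ideal.span_mul_span', Ideal.span_le]
    rintro _ ⟨a, ⟨i', hi, ha⟩, b, ⟨j', hj, hb⟩, rfl⟩
    exact mem_orderGE_of_mem (add_le_add hi hj) (SetLike.mul_mem_graded ha hb)
  exact h (Ideal.mul_mem_mul hx hy)

theorem pow_le_orderGE {I : Ideal S} {d : ℕ} (h : I ≤ orderGE 𝒜 d) (m : ℕ) :
    I ^ m ≤ orderGE 𝒜 (m * d) := by
  induction m with
  | zero => simp [orderGE_zero]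
  | succ m ih =>
    rw [pow_succ, Ideal.mul_le]
    intro x hx y hy
    rw [Nat.succ_mul]
    exact mul_mem_orderGE 𝒜 (ih hx) (h hy)

variable {𝒜}

theorem notMem_orderGE_of_mem {i : ℕ} {x : S} (hx : x ∈ 𝒜 i) (h0 : x ≠ 0) :
    x ∉ orderGE 𝒜 (i + 1) := fun h => h0 <| by
  have := (mem_orderGE_iff 𝒜).1 h i (Nat.lt_succ_self i)
  rwa [DirectSum.decompose_of_mem_same 𝒜 hx] at this

theorem exists_leading {i : ℕ} {x : S} (hx : x ∉ orderGE 𝒜 (i + 1)) :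
    ∃ j ≤ i, ∃ y ∈ 𝒜 j, y ≠ 0 ∧ x - y ∈ orderGE 𝒜 (j + 1) := by
  classical
  have hex : ∃ j, (DirectSum.decompose 𝒜 x j : S) ≠ 0 := by
    by_contra! h
    exact hx ((mem_orderGE_iff 𝒜).2 fun j _ => h j)
  refine ⟨Nat.find hex, ?_, _, SetLike.coe_mem _, Nat.find_spec hex, ?_⟩
  · by_contra! hlt
    refine hx ((mem_orderGE_iff 𝒜).2 fun j hj => ?_)
    by_contra hne
    exact Nat.find_min hex (by omega) hne
  · rw [mem_orderGE_iff]
    intro j hj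
    rw [DirectSum.decompose_sub, DirectSum.sub_apply, Submodule.coe_sub]
    rcases Nat.lt_succ_iff_lt_or_eq.1 hj with hj | hj
    · rw [not_not.1 (Nat.find_min hex hj),
        DirectSum.decompose_of_mem_ne 𝒜 (SetLike.coe_mem _) hj.ne', sub_zero]
    · rw [hj, DirectSum.decompose_of_mem_same 𝒜 (SetLike.coe_mem _), sub_self]

/-- In a domain the product of the lowest terms is nonzero, hence is the lowest term of the product.
-/
theorem mul_notMem_orderGE [IsDomain S] {i j : ℕ} {x y : S} (hx : x ∉ orderGE 𝒜 (i + 1))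
    (hy : y ∉ orderGE 𝒜 (j + 1)) : x * y ∉ orderGE 𝒜 (i + j + 1) := by
  obtain ⟨i', hi, x', hx', hx0, hxx⟩ := exists_leading hx
  obtain ⟨j', hj, y', hy', hy0, hyy⟩ := exists_leading hy
  intro h
  refine notMem_orderGE_of_mem (i := i' + j') (SetLike.mul_mem_graded hx' hy')
    (mul_ne_zero hx0 hy0) ?_
  have h1 : x * y ∈ orderGE 𝒜 (i' + j' + 1) := orderGE_antitone 𝒜 (by omega) h
  have hyj : y ∈ orderGE 𝒜 j' := by
    rw [← sub_add_cancel y y']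
    exact add_mem (orderGE_antitone 𝒜 (by omega) hyy) (mem_orderGE_of_mem le_rfl hy')
  have h2 : (x - x') * y ∈ orderGE 𝒜 (i' + j' + 1) := by
    have := mul_mem_orderGE 𝒜 hxx hyj
    rwa [show i' + 1 + j' = i' + j' + 1 by omega] at this
  have h3 : x' * (y - y') ∈ orderGE 𝒜 (i' + j' + 1) := by
    have := mul_mem_orderGE 𝒜 (mem_orderGE_of_mem le_rfl hx') hyy
    rwa [← add_assoc] at this
  have : x' * y' = x * y - (x - x') * y - x' * (y - y') := by ring
  rw [this]
  exact sub_mem (sub_mem h1 h2) h3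

theorem pow_notMem_orderGE [IsDomain S] {i : ℕ} {x : S} (hx : x ∉ orderGE 𝒜 (i + 1)) (m : ℕ) :
    x ^ m ∉ orderGE 𝒜 (m * i + 1) := by
  induction m with
  | zero =>
    rw [pow_zero, zero_mul]
    exact notMem_orderGE_of_mem (SetLike.one_mem_graded 𝒜) one_ne_zero
  | succ m ih =>
    rw [pow_succ, Nat.succ_mul]
    exact mul_notMem_orderGE ih hx

theorem Ideal.IsHomogeneous.le_orderGE {J : Ideal S} (hJ : J.IsHomogeneous 𝒜) :
    J ≤ orderGE 𝒜 (initialDegree 𝒜 J) := by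
  intro x hx
  rw [mem_orderGE_iff]
  intro i hi
  by_contra hne
  exact absurd (Nat.sInf_le (show i ∈ {d : ℕ | ∃ f ∈ J, f ∈ 𝒜 d ∧ f ≠ 0} from
    ⟨_, hJ i hx, SetLike.coe_mem _, hne⟩)) (not_le.2 hi)

theorem Ideal.IsHomogeneous.exists_mem_ne_zero {J : Ideal S} (hJ : J.IsHomogeneous 𝒜)
    (hne : J ≠ ⊥) : ∃ d, ∃ f ∈ J, f ∈ 𝒜 d ∧ f ≠ 0 := by
  obtain ⟨x, hx, hx0⟩ := Submodule.exists_mem_ne_zero_of_ne_bot hne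
  by_contra! h
  refine hx0 ?_
  classical
  rw [← DirectSum.sum_support_decompose 𝒜 x]
  exact Finset.sum_eq_zero fun i _ => h i _ (hJ i hx) (SetLike.coe_mem _)

/-- If `g ^ t * f ∈ I ^ m` with `g` of order at most `e` and `f` homogeneous of degree `d`, then
`m * α(I) ≤ t * e + d`. -/
theorem Ideal.IsHomogeneous.mul_initialDegree_le [IsDomain S] {I : Ideal S}
    (hI : I.IsHomogeneous 𝒜) {m t e d : ℕ} {g f : S} (hg : g ∉ orderGE 𝒜 (e + 1))
    (hf : f ∈ 𝒜 d) (hf0 : f ≠ 0) (h : g ^ t * f ∈ I ^ m) :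
    m * initialDegree 𝒜 I ≤ t * e + d := by
  by_contra! hlt
  exact mul_notMem_orderGE (pow_notMem_orderGE hg t) (notMem_orderGE_of_mem hf hf0)
    (orderGE_antitone 𝒜 hlt (pow_le_orderGE 𝒜 hI.le_orderGE m h))

end OrderGE

/-! ### Minors of relations and changes of generators -/

section RelationMinor

open Matrix

variable {S : Type*} [CommRing S]

/-- `f` generates `I`, and `g` is the determinant formed by the rows `a` of a square array of
relations among the `f i`. -/
def IsRelationMinor (I : Ideal S) {n r : ℕ} (f : Fin n → S) (a : Fin r → Fin n) (g : S) : Prop :=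
  Ideal.span (Set.range f) = I ∧
    ∃ ρ : Matrix (Fin n) (Fin r) S, f ᵥ* ρ = 0 ∧ g = (ρ.submatrix a id).det

/-- All minors, of the size used for the `c`-th Fitting ideal, of relations among finite generating
families of `I`. -/
def relationMinors (I : Ideal S) (c : ℕ) : Set S :=
  {g | ∃ (n : ℕ) (f : Fin n → S) (a : Fin (n - c) → Fin n), IsRelationMinor I f a g}

/-- Columns of a presentation matrix are relations among the images of the basis vectors. Only this
inclusion is needed, so independence of the presentation never enters. -/
theorem fittingIdeal_le_span_relationMinors (I : Ideal S) (c : ℕ) :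
    fittingIdeal S I c ≤ Ideal.span (relationMinors I c) := by
  simp only [fittingIdeal, iSup_le_iff]
  rintro n q φ ⟨π, hπ, hker⟩
  refine Ideal.span_mono ?_
  rintro _ ⟨a, b, rfl⟩
  have hπf : ∀ v, ((π v : I) : S) = v ⬝ᵥ fun i => ((π (Pi.single i 1) : I) : S) := by
    intro v
    conv_lhs => rw [pi_eq_sum_univ' v]
    simp [dotProduct, Pi.single]
  refine ⟨n, fun i => (π (Pi.single i 1) : I), a, ?_, φ.submatrix id b, ?_, rfl⟩
  · apply le_antisymm
    · rw [Ideal.span_le]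
      rintro _ ⟨i, rfl⟩
      exact SetLike.coe_mem _
    · intro x hx
      obtain ⟨v, hv⟩ := hπ ⟨x, hx⟩
      have : x = ((π v : I) : S) := by rw [hv]
      rw [this, hπf]
      exact sum_mem fun i _ => Ideal.mul_mem_left _ _ (Ideal.subset_span ⟨i, rfl⟩)
  · ext k
    have hmem : φ.mulVecLin (Pi.single (b k) 1) ∈ LinearMap.ker π := by
      rw [hker]; exact ⟨_, rfl⟩
    have h0 : ((π (φ.mulVecLin (Pi.single (b k) 1)) : I) : S) = 0 := by
      rw [LinearMap.mem_ker.1 hmem]; rfl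
    rw [hπf, dotProduct_comm] at h0
    rw [Pi.zero_apply, ← h0]
    simp [vecMul, Matrix.col]
    rfl

/-- Cramer's rule: modulo the generators outside the chosen rows, the square matrix annihilates the
vector of chosen generators, hence so does its determinant. -/
theorem IsRelationMinor.mul_mem {I : Ideal S} {n r : ℕ} {f : Fin n → S} {a : Fin r → Fin n} {g : S}
    (h : IsRelationMinor I f a g) (ha : Function.Injective a) {J : Ideal S}
    (hJ : ∀ i, i ∉ Set.range a → f i ∈ J) {x : S} (hx : x ∈ I) : g * x ∈ J := by
  obtain ⟨hspan, ρ, hρ, rfl⟩ := h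
  set M := ρ.submatrix a id with hM
  have hcol : ∀ k, ((f ∘ a) ᵥ* M) k ∈ J := by
    intro k
    have h0 : ∑ i, f i * ρ i k = 0 := congrFun hρ k
    rw [← Finset.sum_add_sum_compl (Finset.univ.image a),
      Finset.sum_image fun _ _ _ _ h => ha h] at h0
    have h1 : ((f ∘ a) ᵥ* M) k = ∑ l, f (a l) * ρ (a l) k := rfl
    rw [h1, eq_neg_of_add_eq_zero_left h0]
    refine J.neg_mem (sum_mem fun i hi => J.mul_mem_right _ (hJ i ?_))
    simpa using hi
  have hgen : ∀ i, M.det * f i ∈ J := by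
    intro i
    by_cases hi : i ∈ Set.range a
    · obtain ⟨l, rfl⟩ := hi
      have h2 : ((f ∘ a) ᵥ* M) ᵥ* M.adjugate = M.det • (f ∘ a) := by
        rw [vecMul_vecMul, mul_adjugate, vecMul_smul, vecMul_one]
      have h3 : M.det * f (a l) = (((f ∘ a) ᵥ* M) ᵥ* M.adjugate) l := by rw [h2]; rfl
      rw [h3, vecMul, dotProduct]
      exact sum_mem fun k _ => J.mul_mem_right _ (hcol k)
    · exact J.mul_mem_left _ (hJ i hi)
  rw [← hspan] at hx
  induction hx using Submodule.span_induction with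
  | mem x hx => obtain ⟨i, rfl⟩ := hx; exact hgen i
  | zero => simp
  | add x y _ _ hx hy => rw [mul_add]; exact add_mem hx hy
  | smul b x _ hx => rw [smul_eq_mul, mul_left_comm]; exact J.mul_mem_left _ hx

/-- Adding to a generator outside the chosen rows a multiple of another generator changes the minor
by a multiple of another minor. -/
theorem IsRelationMinor.update {I : Ideal S} {n r : ℕ} {f : Fin n → S} {a : Fin r → Fin n} {g : S}
    (h : IsRelationMinor I f a g) (ha : Function.Injective a) {i j : Fin n}
    (hj : j ∉ Set.range a) (hij : i ≠ j) (u : S) :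
    ∃ g', (g' = 0 ∨ ∃ a' : Fin r → Fin n, IsRelationMinor I f a' g') ∧
      IsRelationMinor I (Function.update f j (f j + u * f i)) a (g - u * g') := by
  obtain ⟨hspan, ρ, hρ, rfl⟩ := h
  have hspan' : Ideal.span (Set.range (Function.update f j (f j + u * f i))) = I := by
    apply le_antisymm
    · rw [Ideal.span_le]
      rintro _ ⟨x, rfl⟩
      have hf : ∀ y, f y ∈ I := fun y => hspan ▸ Ideal.subset_span ⟨y, rfl⟩
      by_cases hx : x = j
      · subst hx
        simpa using I.add_mem (hf x) (I.mul_mem_left u (hf i))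
      · simpa [hx] using hf x
    · rw [← hspan, Ideal.span_le]
      have hf : ∀ y, Function.update f j (f j + u * f i) y ∈
          Ideal.span (Set.range (Function.update f j (f j + u * f i))) :=
        fun y => Ideal.subset_span ⟨y, rfl⟩
      rintro _ ⟨x, rfl⟩
      by_cases hx : x = j
      · subst hx
        have h1 := hf x
        have h2 := Ideal.mul_mem_left _ u (hf i)
        simp only [Function.update_self, Function.update_of_ne hij] at h1 h2
        simpa using sub_mem h1 h2
      · have := hf x
        rwa [Function.update_of_ne hx] at this
  -- The change of generators is compensated by the inverse row operation, which touches the minor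
  -- only when `i` is a chosen row.
  have hrel : Function.update f j (f j + u * f i) ᵥ* ρ.updateRow i (ρ i - u • ρ j) = 0 := by
    ext k
    have h0 : ∑ x, f x * ρ x k = 0 := congrFun hρ k
    have hsum : ∀ x, Function.update f j (f j + u * f i) x * ρ.updateRow i (ρ i - u • ρ j) x k =
        f x * ρ x k + (if x = j then u * f i * ρ j k else 0) -
          (if x = i then u * f i * ρ j k else 0) := by
      intro x
      by_cases hx : x = j
      · subst hx
        simp [hij.symm, add_mul]
      · by_cases hxi : x = i
        · subst hxi
          simp [hx]; ring
        · simp [hx, hxi]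
    simp only [vecMul, dotProduct, hsum, Finset.sum_sub_distrib, Finset.sum_add_distrib, h0]
    simp
  by_cases hi : i ∈ Set.range a
  · obtain ⟨l, rfl⟩ := hi
    refine ⟨(ρ.submatrix (Function.update a l j) id).det, Or.inr ⟨_, hspan, ρ, hρ, rfl⟩,
      hspan', _, hrel, ?_⟩
    have h1 : (ρ.updateRow (a l) (ρ (a l) - u • ρ j)).submatrix a id =
        (ρ.submatrix a id).updateRow l (ρ (a l) + (-u) • ρ j) := by
      ext x y
      by_cases hx : x = l
      · subst hx
        simp [sub_eq_add_neg]
      · simp [hx, ha.ne hx]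
    have h2 : ρ.submatrix (Function.update a l j) id = (ρ.submatrix a id).updateRow l (ρ j) := by
      ext x y
      by_cases hx : x = l
      · subst hx
        simp
      · simp [hx]
    have h3 : (ρ.submatrix a id).updateRow l (ρ (a l)) = ρ.submatrix a id := by
      ext x y
      by_cases hx : x = l
      · subst hx
        simp
      · simp [hx]
    rw [h1, det_updateRow_add, det_updateRow_smul, h2, h3]
    ring
  · refine ⟨0, Or.inl rfl, hspan', _, hrel, ?_⟩
    rw [mul_zero, sub_zero]
    congr 1
    ext x y
    have : a x ≠ i := fun h => hi ⟨x, h⟩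
    simp [this]

theorem IsRelationMinor.injective {I : Ideal S} {n r : ℕ} {f : Fin n → S} {a : Fin r → Fin n}
    {g : S} (h : IsRelationMinor I f a g) (hg : g ≠ 0) : Function.Injective a := by
  obtain ⟨-, ρ, -, rfl⟩ := h
  intro x y hxy
  by_contra hne
  exact hg (det_zero_of_row_eq hne (by ext k; simp [hxy]))

/-- Prime avoidance in a coset, valid over any residue field: treat a minimal `p` last, correcting
`u` by an element of `K` that lies in all the other primes but not in `p`. -/
theorem exists_add_mul_notMem (K : Ideal S) (Ps : Finset (Ideal S))
    (hprime : ∀ p ∈ Ps, p.IsPrime) (hK : ∀ p ∈ Ps, ¬ K ≤ p) (a b : S) :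
    ∃ u ∈ K, ∀ p ∈ Ps, (a ∉ p ∨ b ∉ p) → a + u * b ∉ p := by
  classical
  induction Ps using Finset.strongInduction with
  | H Ps ih =>
    rcases Ps.eq_empty_or_nonempty with rfl | hne
    · exact ⟨0, K.zero_mem, by simp⟩
    obtain ⟨p, hp⟩ := Ps.exists_minimal hne
    have hpP := hp.prop
    have := hprime p hpP
    obtain ⟨u, huK, hu⟩ := ih (Ps.erase p) (Finset.erase_ssubset hpP)
      (fun q hq => hprime q (Finset.mem_of_mem_erase hq))
      (fun q hq => hK q (Finset.mem_of_mem_erase hq))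
    have hnot : ¬ K ⊓ (Ps.erase p).inf id ≤ p := by
      rw [Ideal.IsPrime.inf_le ‹_›, Ideal.IsPrime.inf_le' ‹_›]
      rintro (h | ⟨q, hq, hqp⟩)
      · exact hK p hpP h
      · exact (Finset.ne_of_mem_erase hq)
          (le_antisymm hqp (hp.le_of_le (Finset.mem_of_mem_erase hq) hqp))
    obtain ⟨v, hv, hvp⟩ := Set.not_subset.1 hnot
    obtain ⟨hvK, hvq⟩ := hv
    have hvq : ∀ q ∈ Ps.erase p, v ∈ q := fun q hq => (Finset.inf_le (f := id) hq) hvq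
    by_cases hmem : a + u * b ∈ p
    · refine ⟨u + v, K.add_mem huK hvK, fun q hq hab => ?_⟩
      have hexp : a + (u + v) * b = (a + u * b) + v * b := by ring
      rw [hexp]
      by_cases hqp : q = p
      · subst hqp
        rw [q.add_mem_iff_right hmem]
        have hb : b ∉ q := fun hb => by
          rw [q.add_mem_iff_left (q.mul_mem_left _ hb)] at hmem
          tauto
        exact fun h => (this.mem_or_mem h).elim hvp hb
      · have hq' := Finset.mem_erase.2 ⟨hqp, hq⟩
        rw [q.add_mem_iff_left (q.mul_mem_right _ (hvq q hq'))]
        exact hu q hq' hab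
    · refine ⟨u, huK, fun q hq hab => ?_⟩
      by_cases hqp : q = p
      · rwa [hqp]
      · exact hu q (Finset.mem_erase.2 ⟨hqp, hq⟩) hab

/-- One generator outside the chosen rows can be moved out of finitely many primes, without changing
the minor modulo an ideal `B` that contains the products of elements of `I` and minors. -/
theorem IsRelationMinor.exists_avoid {I B : Ideal S} {c n : ℕ}
    (hB : ∀ u ∈ I, ∀ h ∈ relationMinors I c, u * h ∈ B)
    {f : Fin n → S} {a : Fin (n - c) → Fin n} {g : S}
    (h : IsRelationMinor I f a g) (ha : Function.Injective a) (hg : g ∉ B) {j : Fin n}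
    (hj : j ∉ Set.range a) (Ps : Finset (Ideal S)) (hprime : ∀ p ∈ Ps, p.IsPrime)
    (hI : ∀ p ∈ Ps, ¬ I ≤ p) (T : Finset (Fin n)) (hjT : j ∉ T) :
    ∃ f' g', IsRelationMinor I f' a g' ∧ g' ∉ B ∧ (∀ i, i ≠ j → f' i = f i) ∧
      ∀ p ∈ Ps, (f j ∉ p ∨ ∃ i ∈ T, f i ∉ p) → f' j ∉ p := by
  induction T using Finset.induction_on with
  | empty => exact ⟨f, g, h, hg, fun _ _ => rfl, by simp⟩
  | insert i T hiT ih =>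
    rw [Finset.mem_insert, not_or] at hjT
    obtain ⟨f', g', h', hg', hf', hp'⟩ := ih hjT.2
    obtain ⟨u, hu, hup⟩ := exists_add_mul_notMem I Ps hprime hI (f' j) (f' i)
    obtain ⟨g'', hg'', h''⟩ := h'.update ha hj (Ne.symm hjT.1) u
    have huB : u * g'' ∈ B := by
      rcases hg'' with rfl | ⟨a', hm⟩
      · simp
      · exact hB u hu g'' ⟨n, f', a', hm⟩
    refine ⟨_, _, h'', ?_, ?_, ?_⟩
    · rwa [B.sub_mem_iff_left huB]
    · intro x hx
      rw [Function.update_of_ne hx, hf' x hx]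
    · intro p hp hcond
      rw [Function.update_self]
      refine hup p hp ?_
      rw [hf' i (Ne.symm hjT.1)]
      rcases hcond with hc | ⟨x, hx, hxp⟩
      · exact Or.inl (hp' p hp (Or.inl hc))
      · rcases Finset.mem_insert.1 hx with rfl | hx
        · exact Or.inr hxp
        · exact Or.inl (hp' p hp (Or.inr ⟨x, hx, hxp⟩))

/-- In a Cohen-Macaulay ring the generators outside the chosen rows can be made a regular sequence,
without changing the minor modulo `B`. -/
theorem IsRelationMinor.exists_isRegularSeqMod [IsNoetherianRing S] (hCM : IsCohenMacaulayRing S)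
    {I B : Ideal S} {c n : ℕ} (hc : I.height = c)
    (hB : ∀ u ∈ I, ∀ h ∈ relationMinors I c, u * h ∈ B)
    {f : Fin n → S} {a : Fin (n - c) → Fin n} {g : S}
    (h : IsRelationMinor I f a g) (ha : Function.Injective a) (hg : g ∉ B)
    (l : List (Fin n)) (hl : l.Nodup) (hla : ∀ j ∈ l, j ∉ Set.range a) (hlen : l.length ≤ c) :
    ∃ f' g', IsRelationMinor I f' a g' ∧ g' ∉ B ∧ (⊥ : Ideal S).IsRegularSeqMod (l.map f') := by
  induction l using List.reverseRecOn with
  | nil => exact ⟨f, g, h, hg, trivial⟩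
  | append_singleton l j ih =>
    simp only [List.length_append, List.length_singleton] at hlen
    have hjl : j ∉ l := by
      rw [List.nodup_append] at hl
      exact fun hj => hl.2.2 j hj j (by simp) rfl
    obtain ⟨f₁, g₁, h₁, hg₁, hreg⟩ := ih (hl.of_append_left)
      (fun x hx => hla x (by simp [hx])) (by omega)
    have hfin := Ideal.finite_associatedPrimes_quotient (Ideal.ofList (l.map f₁))
    -- These primes have height at most `l.length < c`.
    have hnotle : ∀ p ∈ hfin.toFinset, ¬ I ≤ p := by
      intro p hp hle
      rw [Set.Finite.mem_toFinset] at hp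
      have h2 := (Ideal.height_mono hle).trans (Ideal.height_le_of_mem_associatedPrimes hCM hreg hp)
      rw [hc, List.length_map, Nat.cast_le] at h2
      omega
    obtain ⟨f₂, g₂, h₂, hg₂, hf₂, hp₂⟩ := h₁.exists_avoid hB ha hg₁ (hla j (by simp)) hfin.toFinset
      (fun p hp => IsAssociatedPrime.isPrime (hfin.mem_toFinset.1 hp)) hnotle
      -- All other generators are allowed in the correction: a prime not containing `I` misses at
      -- least one generator.
      (Finset.univ.filter fun i => i ≠ j) (by simp)
    refine ⟨f₂, g₂, h₂, hg₂, ?_⟩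
    have hmap : l.map f₂ = l.map f₁ :=
      List.map_congr_left fun x hx => hf₂ x (by rintro rfl; exact hjl hx)
    rw [List.map_append, List.map_singleton, Ideal.isRegularSeqMod_concat, hmap, bot_sup_eq]
    refine ⟨hreg, Ideal.isRegularMod_iff_forall_notMem.2 fun p hp => ?_⟩
    have hpP := hfin.mem_toFinset.2 hp
    refine hp₂ p hpP ?_
    by_contra! hcon
    refine hnotle p hpP ?_
    rw [← h₁.1, Ideal.span_le]
    rintro _ ⟨i, rfl⟩
    by_cases hij : i = j
    · rw [hij]; exact hcon.1
    · exact hcon.2 i (by simp [hij])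

end RelationMinor

/-! ### Multiplying symbolic powers into ordinary powers -/

section SymbolicPower

variable {S : Type*} [CommRing S]

theorem pow_le_symbolicPower (I : Ideal S) (m : ℕ) : I ^ m ≤ symbolicPower I m :=
  le_iInf₂ fun _ _ => Ideal.le_comap_map

theorem exists_notMem_mul_mem_of_mem_symbolicPower {I : Ideal S} {m : ℕ} {x : S}
    (hx : x ∈ symbolicPower I m) {p : Ideal S} (hp : p ∈ associatedPrimes S (S ⧸ I)) :
    ∃ s, s ∉ p ∧ s * x ∈ I ^ m := by
  have hprime : p.IsPrime := IsAssociatedPrime.isPrime hp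
  simp only [symbolicPower, Submodule.mem_iInf] at hx
  have := hx ⟨p, hprime⟩ hp
  rw [Ideal.mem_comap, IsLocalization.algebraMap_mem_map_algebraMap_iff p.primeCompl] at this
  exact this

theorem mem_associatedPrimes_of_height_le [IsNoetherianRing S] {I p : Ideal S} [p.IsPrime]
    (hle : I ≤ p) (h : p.height ≤ I.height) : p ∈ associatedPrimes S (S ⧸ I) := by
  refine Module.associatedPrimes.minimalPrimes_annihilator_subset_associatedPrimes S (S ⧸ I) ?_
  rw [Ideal.annihilator_quotient]
  exact Ideal.mem_minimalPrimes_of_height_le hle h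

/-- If `J ≤ I` is generated by a regular sequence of length at most the height of `I` and
`g I ≤ J`, then `g ^ t` multiplies the symbolic power `I^(t+1)` into `I ^ (t + 1)`. -/
theorem pow_mul_mem_of_mem_symbolicPower [IsNoetherianRing S] (hCM : IsCohenMacaulayRing S)
    {I : Ideal S} {xs : List S} (hxs : (⊥ : Ideal S).IsRegularSeqMod xs)
    (hlen : (xs.length : ℕ∞) ≤ I.height) (hJI : Ideal.ofList xs ≤ I) {g : S}
    (hg : ∀ y ∈ I, g * y ∈ Ideal.ofList xs) {t : ℕ} {x : S} (hx : x ∈ symbolicPower I (t + 1)) :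
    g ^ t * x ∈ I ^ (t + 1) := by
  set J := Ideal.ofList xs with hJ
  have hpow : ∀ y ∈ I ^ (t + 1), g ^ t * y ∈ J ^ t * I := by
    have h1 : Ideal.span {g} * I ≤ J := by
      rw [Ideal.span_singleton_mul_le_iff]; exact hg
    have h2 : Ideal.span {g ^ t} * I ^ (t + 1) ≤ J ^ t * I := by
      rw [← Ideal.span_singleton_pow, pow_succ, ← mul_assoc, ← mul_pow]
      exact Ideal.mul_mono_left (Ideal.pow_right_mono h1 t)
    exact fun y hy => h2 (Ideal.mul_mem_mul (Ideal.mem_span_singleton_self _) hy)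
  have hassI : ∀ p ∈ associatedPrimes S (S ⧸ I), ∃ s, s ∉ p ∧ s * (g ^ t * x) ∈ J ^ t * I := by
    intro p hp
    obtain ⟨s, hs, hsx⟩ := exists_notMem_mul_mem_of_mem_symbolicPower hx hp
    refine ⟨s, hs, ?_⟩
    rw [mul_left_comm]
    exact hpow _ hsx
  have hassJ : ∀ p ∈ associatedPrimes S (S ⧸ J), ∃ s, s ∉ p ∧ s * (g ^ t * x) ∈ J ^ t * I := by
    intro p hp
    have hprime : p.IsPrime := IsAssociatedPrime.isPrime hp
    -- If `I ≤ p`, the height bound makes `p` minimal over `I`, hence associated to `I`. Otherwise a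
    -- power of some `y ∈ I` outside `p` serves as multiplier.
    by_cases hIp : I ≤ p
    · exact hassI p (mem_associatedPrimes_of_height_le hIp
        ((Ideal.height_le_of_mem_associatedPrimes hCM hxs hp).trans hlen))
    · obtain ⟨y, hy, hyp⟩ := Set.not_subset.1 hIp
      refine ⟨y ^ (t + 1), fun h => hyp (hprime.mem_of_pow_mem _ h), ?_⟩
      have : y ^ (t + 1) * (g ^ t * x) = (g * y) ^ t * (y * x) := by ring
      rw [this]
      exact Ideal.mul_mem_mul (Ideal.pow_mem_pow (hg y hy) t) (I.mul_mem_right _ hy)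
  obtain ⟨s, hsK, hs⟩ := Ideal.exists_isRegularMod_forall
    ((J ^ t * I).colon {g ^ t * x}) (Js := {J, I}) (by simp) (by
      rintro K hK p hp hle
      have : ∃ s, s ∉ p ∧ s * (g ^ t * x) ∈ J ^ t * I := by
        rcases hK with rfl | rfl
        · exact hassJ p hp
        · exact hassI p hp
      obtain ⟨s, hsp, hs⟩ := this
      exact hsp (hle (Submodule.mem_colon_singleton.2 hs)))
  have hsw : s * (g ^ t * x) ∈ J ^ t * I := Submodule.mem_colon_singleton.1 hsK
  -- Since `s` is regular modulo `J`, it can be cancelled one power of `J` at a time; regularity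
  -- modulo `I` gives the last step.
  have hstep : ∀ i ≤ t, g ^ t * x ∈ J ^ i := by
    intro i
    induction i with
    | zero => simp
    | succ i ih =>
      intro hi
      rw [pow_succ]
      refine Ideal.mem_pow_mul_of_isRegularMod hxs i le_rfl (hs J (by simp)) (ih (by omega)) ?_
      rw [← pow_succ]
      exact Ideal.pow_le_pow_right hi (Ideal.mul_le_left hsw)
  have := Ideal.mem_pow_mul_of_isRegularMod hxs t hJI (hs I (by simp)) (hstep t le_rfl) hsw
  rw [pow_succ]
  exact Ideal.mul_mono_left (Ideal.pow_right_mono hJI t) this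

/-- For `I` of height `c` and `B` an ideal containing the products of elements of `I` and minors,
every minor can be replaced, modulo `B`, by one whose `t`-th power multiplies the symbolic power
`I^(t+1)` into `I ^ (t + 1)`. -/
theorem exists_relationMinor_pow_mul_mem [IsNoetherianRing S] (hCM : IsCohenMacaulayRing S)
    {I B : Ideal S} {c : ℕ} (hc : I.height = c)
    (hB : ∀ u ∈ I, ∀ h ∈ relationMinors I c, u * h ∈ B)
    {g : S} (hg : g ∈ relationMinors I c) (hgB : g ∉ B) (t : ℕ) :
    ∃ g' ∉ B, ∀ x ∈ symbolicPower I (t + 1), g' ^ t * x ∈ I ^ (t + 1) := by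
  obtain ⟨n, f, a, h⟩ := hg
  have ha := h.injective (fun h0 => hgB (h0 ▸ B.zero_mem))
  let l := ((Finset.univ.image a)ᶜ).toList
  have hmem : ∀ j, j ∈ l ↔ j ∉ Set.range a := fun j => by simp [l]
  have hlen : l.length ≤ c := by
    simp only [l, Finset.length_toList, Finset.card_compl, Finset.card_image_of_injective _ ha,
      Finset.card_univ, Fintype.card_fin]
    omega
  obtain ⟨f', g', h', hg', hreg⟩ := h.exists_isRegularSeqMod hCM hc hB ha hgB l
    (Finset.nodup_toList _) (fun j hj => (hmem j).1 hj) hlen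
  refine ⟨g', hg', fun x hx => pow_mul_mem_of_mem_symbolicPower hCM hreg ?_ ?_ (fun y hy => ?_) hx⟩
  · rw [hc, List.length_map]
    exact_mod_cast hlen
  · rw [Ideal.ofList, Ideal.span_le]
    intro y hy
    obtain ⟨i, -, rfl⟩ := List.mem_map.1 hy
    rw [← h'.1]
    exact Ideal.subset_span ⟨i, rfl⟩
  · exact h'.mul_mem ha (fun i hi => Ideal.subset_span (List.mem_map.2 ⟨i, (hmem i).2 hi, rfl⟩)) hy

/-- The Koszul relations show that high powers of a nonzero element of `I` lie in the Fitting
ideals. -/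
theorem exists_pow_mem_fittingIdeal [IsNoetherianRing S] (I : Ideal S) {h : S} (hh : h ∈ I) {c : ℕ}
    (hc : c ≠ 0) : ∃ r, h ^ r ∈ fittingIdeal S I c := by
  obtain ⟨n, v, hv⟩ := Submodule.fg_iff_exists_fin_generating_family.1
    (IsNoetherian.noetherian (⊤ : Submodule S I))
  -- With `h` as an extra generator, the Koszul relations `κ` between `h` and the `v i` put a block
  -- `h • 1` in the rows other than the first.
  let w : Fin (n + 1) → I := Fin.cons ⟨h, hh⟩ v
  let π : (Fin (n + 1) → S) →ₗ[S] I := Fintype.linearCombination S w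
  obtain ⟨q, ψ, hψ⟩ := Submodule.fg_iff_exists_fin_generating_family.1
    (IsNoetherian.noetherian (LinearMap.ker π))
  let κ : Fin n → Fin (n + 1) → S := fun i => h • Pi.single i.succ 1 - (v i : S) • Pi.single 0 1
  have hπ : Function.Surjective π := by
    rw [← LinearMap.range_eq_top, Fintype.range_linearCombination, eq_top_iff, ← hv]
    refine Submodule.span_mono ?_
    rintro _ ⟨i, rfl⟩
    exact ⟨i.succ, by simp [w]⟩
  have hκ : ∀ i, κ i ∈ LinearMap.ker π := by
    intro i
    rw [LinearMap.mem_ker]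
    ext
    simp [κ, π, w, map_sub, Fintype.linearCombination_apply_single, mul_comm]
  let φ : Matrix (Fin (n + 1)) (Fin (q + n)) S := Matrix.of fun i j => Fin.append ψ κ j i
  have hφ : IsPresentationMatrix I φ := by
    refine ⟨π, hπ, ?_⟩
    rw [Matrix.range_mulVecLin]
    have : Set.range φ.col = Set.range ψ ∪ Set.range κ := by
      ext x
      constructor
      · rintro ⟨i, rfl⟩
        refine Fin.addCases (fun i => Or.inl ⟨i, ?_⟩) (fun i => Or.inr ⟨i, ?_⟩) i <;>
          ext <;> simp [φ]
      · rintro (⟨i, rfl⟩ | ⟨i, rfl⟩)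
        · exact ⟨Fin.castAdd n i, by ext; simp [φ]⟩
        · exact ⟨Fin.natAdd q i, by ext; simp [φ]⟩
    rw [this, Submodule.span_union, hψ, eq_comm, sup_eq_left, Submodule.span_le]
    rintro _ ⟨i, rfl⟩
    exact hκ i
  refine ⟨n + 1 - c, ?_⟩
  have hle : n + 1 - c ≤ n := by omega
  have hmem : h ^ (n + 1 - c) ∈ minorsIdeal φ (n + 1 - c) := by
    refine Ideal.subset_span ⟨fun i => (Fin.castLE hle i).succ,
      fun i => Fin.natAdd q (Fin.castLE hle i), ?_⟩
    have : φ.submatrix (fun i => (Fin.castLE hle i).succ)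
        (fun i => Fin.natAdd q (Fin.castLE hle i)) = Matrix.diagonal fun _ => h := by
      ext i j
      by_cases hij : i = j
      · subst hij
        simp [φ, κ]
      · simp [φ, κ, hij]
    rw [this]
    simp
  exact (le_iSup_of_le (n + 1) (le_iSup_of_le (q + n) (le_iSup₂_of_le φ hφ le_rfl)) :
    minorsIdeal φ (n + 1 - c) ≤ fittingIdeal S I c) hmem

end SymbolicPower

theorem corollary5p9 {k S : Type*} [Field k] [CommRing S] [IsDomain S] [IsNoetherianRing S]
    [Algebra k S] (𝒜 : ℕ → Submodule k S) [GradedAlgebra 𝒜]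
    (hCM : IsCohenMacaulayRing S)
    (I : Ideal S) (hI : I.IsHomogeneous 𝒜) (hI_ne_bot : I ≠ ⊥) (hI_ne_top : I ≠ ⊤)
    (c : ℕ) (hc : I.height = c) (hunm : IsUnmixedOfHeight I c)
    (hgci : IsGenericallyCompleteIntersection I)
    (m : ℕ) (hm : 1 ≤ m) :
    (∀ t₀ : ℕ,
      symbolicPower I m =
          (I ^ m).colon ((fittingIdeal S I c ^ t₀ : Ideal S) : Set S) →
        (initialDegree 𝒜 (symbolicPower I m) : ℤ) ≥
          m * (initialDegree 𝒜 I : ℤ) - t₀ * (initialDegree 𝒜 (fittingIdeal S I c) : ℤ)) ∧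
    (initialDegree 𝒜 (symbolicPower I m) : ℤ) ≥
      m * ((initialDegree 𝒜 I : ℤ) - (initialDegree 𝒜 (fittingIdeal S I c) : ℤ)) +
        (initialDegree 𝒜 (fittingIdeal S I c) : ℤ) := by
  obtain ⟨d, h, hhI, hhd, hh0⟩ := hI.exists_mem_ne_zero hI_ne_bot
  obtain ⟨f, hf, hfd, hf0⟩ := exists_mem_initialDegree (𝒜 := 𝒜) (J := symbolicPower I m)
    ⟨m • d, h ^ m, pow_le_symbolicPower I m (Ideal.pow_mem_pow hhI m),
      SetLike.pow_mem_graded m hhd, pow_ne_zero m hh0⟩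
  obtain ⟨r, hr⟩ := exists_pow_mem_fittingIdeal I hhI (c := c)
    (fun h0 => hI_ne_bot (Ideal.height_eq_zero_iff_eq_bot.1 (by simp [hc, h0])))
  obtain ⟨g, hg, hgd, hg0⟩ := exists_mem_initialDegree (𝒜 := 𝒜) (J := fittingIdeal S I c)
    ⟨r • d, h ^ r, hr, SetLike.pow_mem_graded r hhd, pow_ne_zero r hh0⟩
  have hgord := notMem_orderGE_of_mem hgd hg0
  constructor
  · intro t₀ ht₀
    rw [ht₀, Submodule.mem_colon] at hf
    have hmem : g ^ t₀ * f ∈ I ^ m := by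
      rw [mul_comm]
      exact hf _ (Ideal.pow_mem_pow hg t₀)
    have := hI.mul_initialDegree_le hgord hfd hf0 hmem
    zify at this
    linarith
  · obtain ⟨t, rfl⟩ : ∃ t, m = t + 1 := ⟨m - 1, by omega⟩
    -- If `α(I) = 0` the right-hand side is `-t α(F_c(I)) ≤ 0`; otherwise multiplying by an element
    -- of `I` raises the order.
    rcases Nat.eq_zero_or_pos (initialDegree 𝒜 I) with h0 | hpos
    · rw [h0]
      push_cast
      nlinarith [mul_nonneg (Nat.cast_nonneg (α := ℤ) t)
        (Nat.cast_nonneg (α := ℤ) (initialDegree 𝒜 (fittingIdeal S I c)))]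
    -- The minors need not be homogeneous, so the least order of a minor is used; it is at most
    -- `α(F_c(I))` because minors span an ideal containing `F_c(I)`.
    have hex : ∃ e, ∃ x ∈ relationMinors I c, x ∉ orderGE 𝒜 (e + 1) := by
      refine ⟨initialDegree 𝒜 (fittingIdeal S I c), ?_⟩
      by_contra! hcon
      exact hgord (((fittingIdeal_le_span_relationMinors I c).trans (Ideal.span_le.2 hcon)) hg)
    classical
    have hle : Nat.find hex ≤ initialDegree 𝒜 (fittingIdeal S I c) := by
      refine Nat.find_min' hex ?_
      by_contra! hcon
      exact hgord (((fittingIdeal_le_span_relationMinors I c).trans (Ideal.span_le.2 hcon)) hg)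
    obtain ⟨x, hx, hxe⟩ := Nat.find_spec hex
    have hmin : ∀ y ∈ relationMinors I c, y ∈ orderGE 𝒜 (Nat.find hex) := by
      intro y hy
      rcases hE : Nat.find hex with _ | e
      · simp [orderGE_zero]
      · by_contra hcon
        exact Nat.find_min hex (m := e) (by omega) ⟨y, hy, hcon⟩
    obtain ⟨g', hg', hpow⟩ := exists_relationMinor_pow_mul_mem hCM hc
      (B := orderGE 𝒜 (Nat.find hex + 1)) (fun u hu y hy => by
        rw [add_comm]
        exact mul_mem_orderGE 𝒜 (orderGE_antitone 𝒜 hpos (hI.le_orderGE hu)) (hmin y hy))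
      hx hxe t
    have := hI.mul_initialDegree_le hg' hfd hf0 (hpow f hf)
    have h2 := Nat.mul_le_mul_left t hle
    zify at this h2
    push_cast
    linarith
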